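/- For every integer $n\ge 1$ let $z_0^n\in\mathbb{R}^n$ and let $Z^n=(Z^n_t)_{t\ge 0}$ be the Ornstein–Uhlenbeck process on $\mathbb{R}^n$ solving $$Z^n_0=z^n_0,\qquad \mathrm{d}Z^n_t=\sqrt{\tfrac{2}{n}}\,\mathrm{d}B^n_t-Z^n_t\,\mathrm{d}t,$$ where $B^n$ is a standard $n$-dimensional Brownian motion, and let $P_n^0=\mathcal{N}(0,\tfrac1n I_n)$ be its invariant law. Write $|\cdot|$ for the Euclidean norm and $\|\mu-\nu\|_{\mathrm{TV}}=\sup_A|\mu(A)-\nu(A)|$, the supremum being over Borel sets. Assume that the limit $$a:=\lim_{n\to\infty}\sqrt n\,|z_0^n|^2\in[0,+\infty]$$ exists. For $b\in\mathbb{R}$ put $$t_{n,b}:=\begin{cases}\log(|z_0^n|\sqrt n)+b&\text{if }a=+\infty,\\[2pt] \tfrac14\log n+b&\text{if }a\in[0,+\infty)\end{cases}$$ (which is well defined and nonnegative for all large $n$). Then, for all $b\in\mathbb{R}$, $$\lim_{n\to\infty}\bigl\|\mathrm{Law}(Z^n_{t_{n,b}})-P_n^0\bigr\|_{\mathrm{TV}}=\phi(b),\qquad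 \phi(b):=\begin{cases} \mathrm{erf}\Bigl(\dfrac{\mathrm{e}^{-b}}{2\sqrt2}\Bigr)&\text{if }a=+\infty,\\[6pt] \mathrm{erf}\Bigl(\dfrac{\mathrm{e}^{-2b}}{4}\Bigr)&\text{if }a=0,\\[6pt] \mathrm{erf}\Bigl(\dfrac{\sqrt{2a\,\mathrm{e}^{-2b}+\mathrm{e}^{-4b}}}{4}\Bigr)&\text{if }a\in(0,+\infty), \end{cases}$$ where $\mathrm{erf}(u):=\frac{1}{\sqrt\pi}\int_{|t|\le u}\mathrm{e}^{-t^2}\,\mathrm{d}t=\mathbb{P}(|X|\le\sqrt2\,u)$ with $X\sim\mathcal{N}(0,1)$. -/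

import Mathlib

open MeasureTheory ProbabilityTheory Filter Topology
open scoped ENNReal NNReal

/-- Total variation distance `‖μ - ν‖_TV = sup_A |μ(A) - ν(A)|`, the supremum running over the
measurable sets (a real number in `[0, 1]` when `μ` and `ν` are probability measures). -/
noncomputable def tvDistance {E : Type*} [MeasurableSpace E] (μ ν : Measure E) : ℝ :=
  ⨆ A : {A : Set E // MeasurableSet A}, |μ.real A.1 - ν.real A.1|

/-- Standard `n`-dimensional Brownian motion: the coordinate processes are independent standard
real Brownian motions. -/
structure IsBrownianVec {Ω : Type*} [MeasurableSpace Ω] {n : ℕ}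
    (B : ℝ≥0 → Ω → EuclideanSpace ℝ (Fin n)) (P : Measure Ω) : Prop where
  brownian : ∀ i : Fin n, IsBrownianReal (fun t ω => B t ω i) P
  indep : iIndepFun (fun (i : Fin n) (ω : Ω) (t : ℝ≥0) => B t ω i) P

/-- `Z` solves `Z_0 = z₀`, `dZ_t = √(2/n) dB_t - Z_t dt` on `ℝⁿ`, where `B` is a standard
`n`-dimensional Brownian motion. The diffusion coefficient is constant, so the stochastic
integral is `√(2/n) (B_t - B_0)` and the equation is written in integrated form. -/
structure IsOUProcess {Ω : Type*} [MeasurableSpace Ω] {n : ℕ}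
    (Z B : ℝ≥0 → Ω → EuclideanSpace ℝ (Fin n)) (z₀ : EuclideanSpace ℝ (Fin n))
    (P : Measure Ω) : Prop where
  isBrownianVec : IsBrownianVec B P
  aemeasurable : ∀ t, AEMeasurable (Z t) P
  continuous : ∀ᵐ ω ∂P, Continuous (fun t => Z t ω)
  initial : ∀ᵐ ω ∂P, Z 0 ω = z₀
  equation : ∀ᵐ ω ∂P, ∀ t : ℝ≥0,
    Z t ω = Z 0 ω + √(2 / (n : ℝ)) • (B t ω - B 0 ω)
      - ∫ s in (0 : ℝ)..(t : ℝ), Z s.toNNReal ω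

/-- The invariant law `N(0, Iₙ / n)` of the Ornstein-Uhlenbeck process on `ℝⁿ`. -/
noncomputable def ouInvariantLaw (n : ℕ) : Measure (EuclideanSpace ℝ (Fin n)) :=
  multivariateGaussian 0 ((1 / (n : ℝ)) • (1 : Matrix (Fin n) (Fin n) ℝ))

/-- The time `t_{n,b}`, for an initial condition of Euclidean norm `r = |z₀ⁿ|`, where
`a = lim √n |z₀ⁿ|²`. -/
noncomputable def ouCutoffTime (a : ℝ≥0∞) (r : ℝ) (n : ℕ) (b : ℝ) : ℝ :=
  open Classical in
  if a = ∞ then Real.log (r * √(n : ℝ)) + b else Real.log n / 4 + b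

/-- The error function `erf u = π^{-1/2} ∫_{|t| ≤ u} exp (-t²) dt`. -/
noncomputable def errorFn (u : ℝ) : ℝ :=
  1 / √Real.pi * ∫ t in {t : ℝ | |t| ≤ u}, Real.exp (-t ^ 2)

/-- The total variation cutoff profile. -/
noncomputable def ouProfile (a : ℝ≥0∞) (b : ℝ) : ℝ :=
  open Classical in
  if a = ∞ then errorFn (Real.exp (-b) / (2 * √2))
  else if a = 0 then errorFn (Real.exp (-2 * b) / 4)
  else errorFn (√(2 * a.toReal * Real.exp (-2 * b) + Real.exp (-4 * b)) / 4)

/-! The process at time `t` is Gaussian, with mean `e^{-t} z₀` and covariance `(1 - e^{-2t})/n`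
times the identity. Multiplying by `√n` does not change total variation and turns the question into
comparing a product of `N(mᵢ, 1/(1+d))` with a product of `N(0,1)`, where `∑ mᵢ² = n e^{-2t} |z₀|²`
and `d = e^{-2t}/(1 - e^{-2t})`.

Total variation equals `E[(1 - e^Λ)⁺]` under the second product, `Λ` being the log-likelihood ratio,
a sum of independent quadratic functions of Gaussians. If `d → 0`, `n d² → L` and `∑ mᵢ² → M`,
explicit characteristic functions show that `Λ` converges in law to `N(-s²/2, s²)` with `s² = L/2 +
M` (`tendsto_charFun_map_sum_gaussianLogRatio`). Since `(1 - e^y)⁺` is bounded and continuous, the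
distance tends to its expectation under that law, which is `P(|X| ≤ s/2)` for standard normal `X`.

The cutoff times are those for which `L` and `M` converge with `s > 0`: only the mean contributes
when `a = ∞`, only the variance when `a = 0`, and both otherwise. -/

/-! ### Pathwise variation of constants by Riemann sums. -/

section Pathwise

variable {E : Type*} [NormedAddCommGroup E] [NormedSpace ℝ E]

/-- The regular subdivision of `[0, t]` into `N + 1` intervals. -/
noncomputable def gridPoint (t : ℝ≥0) (N k : ℕ) : ℝ≥0 := (k : ℝ≥0) / ((N : ℝ≥0) + 1) * t

lemma coe_gridPoint (t : ℝ≥0) (N k : ℕ) :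
    (gridPoint t N k : ℝ) = (k : ℝ) / ((N : ℝ) + 1) * t := by
  simp [gridPoint]

lemma gridPoint_zero (t : ℝ≥0) (N : ℕ) : gridPoint t N 0 = 0 := by simp [gridPoint]

lemma gridPoint_last (t : ℝ≥0) (N : ℕ) : gridPoint t N (N + 1) = t := by
  have : ((N : ℝ≥0) + 1) ≠ 0 := by positivity
  simp [gridPoint, this]

lemma gridPoint_succ_sub (t : ℝ≥0) (N k : ℕ) :
    (gridPoint t N (k + 1) : ℝ) - gridPoint t N k = (t : ℝ) / ((N : ℝ) + 1) := by
  rw [coe_gridPoint, coe_gridPoint]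
  push_cast
  field_simp
  ring

lemma gridPoint_mono (t : ℝ≥0) (N : ℕ) : Monotone (gridPoint t N) := by
  refine monotone_nat_of_le_succ fun k => ?_
  have h := gridPoint_succ_sub t N k
  have : (0 : ℝ) ≤ (t : ℝ) / ((N : ℝ) + 1) := by positivity
  rw [← NNReal.coe_le_coe]
  linarith

/-- A weighted sum of increments of the driving path converges to the solution of the linear
integral equation. -/
lemma tendsto_sum_exp_smul_increments [CompleteSpace E] {z w : ℝ≥0 → E} {l : ℝ}
    (hz : Continuous z)
    (h : ∀ t : ℝ≥0, z t = z 0 + (w t - w 0) - l • ∫ s in (0 : ℝ)..(t : ℝ), z s.toNNReal)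
    (t : ℝ≥0) :
    Tendsto (fun N : ℕ => ∑ k ∈ Finset.range (N + 1),
        Real.exp (l * (gridPoint t N k - t)) •
          (w (gridPoint t N (k + 1)) - w (gridPoint t N k))) atTop
      (𝓝 (z t - Real.exp (-(l * t)) • z 0)) := by
  set y : ℝ → E := fun s => z s.toNNReal with hy
  have hyc : Continuous y := hz.comp continuous_real_toNNReal
  have hyz (s : ℝ≥0) : y s = z s := by simp [hy]
  have hincr (a b : ℝ≥0) : w b - w a = z b - z a + l • ∫ s in (a : ℝ)..(b : ℝ), y s := by
    have h1 := intervalIntegral.integral_interval_sub_left (μ := volume)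
      (hyc.intervalIntegrable 0 b) (hyc.intervalIntegrable 0 a)
    rw [← h1, smul_sub, h a, h b]
    abel
  -- On each cell, the increment of `e^{l(s-t)} z s` minus the corresponding term of the sum is the
  -- integral over `s` of `H (s, τ (k + 1), τ k)`. As `H` vanishes on the diagonal, uniform
  -- continuity makes it small on a fine mesh.
  let H : ℝ × ℝ × ℝ → E := fun p =>
    (l * Real.exp (l * (p.1 - t))) • y p.2.1 - (l * Real.exp (l * (p.2.2 - t))) • y p.1
  have hH : Continuous H := by fun_prop
  have hHu : UniformContinuousOn H
      (Set.Icc 0 (t : ℝ) ×ˢ (Set.Icc 0 (t : ℝ) ×ˢ Set.Icc 0 (t : ℝ))) :=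
    (isCompact_Icc.prod (isCompact_Icc.prod isCompact_Icc)).uniformContinuousOn_of_continuous
      hH.continuousOn
  rw [Metric.tendsto_atTop]
  intro ε hε
  -- The cell errors add up to at most `ε t / (t + 1) < ε`; the `+ 1` covers `t = 0`.
  obtain ⟨δ, hδ, hHδ⟩ := Metric.uniformContinuousOn_iff.1 hHu (ε / (t + 1)) (by positivity)
  obtain ⟨N₀, hN₀⟩ := exists_nat_gt ((t : ℝ) / δ)
  refine ⟨N₀, fun N hN => ?_⟩
  have hNpos : (0 : ℝ) < (N : ℝ) + 1 := by positivity
  have hmesh : (t : ℝ) / ((N : ℝ) + 1) < δ := by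
    have : (N₀ : ℝ) ≤ N := by exact_mod_cast hN
    rw [div_lt_iff₀ hδ] at hN₀
    rw [div_lt_iff₀ hNpos]
    nlinarith
  set τ := gridPoint t N with hτ
  have hstep (k : ℕ) (hk : k ∈ Finset.range (N + 1)) :
      ‖Real.exp (l * (τ (k + 1) - t)) • z (τ (k + 1)) - Real.exp (l * (τ k - t)) • z (τ k)
        - Real.exp (l * (τ k - t)) • (w (τ (k + 1)) - w (τ k))‖
        ≤ ε / (t + 1) * (t / ((N : ℝ) + 1)) := by
    have hle : (τ k : ℝ) ≤ τ (k + 1) := by exact_mod_cast gridPoint_mono t N (Nat.le_succ k)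
    have hlast : (τ (k + 1) : ℝ) ≤ t := by
      have := gridPoint_mono t N (Finset.mem_range.1 hk)
      rw [gridPoint_last] at this
      exact_mod_cast this
    have hexp : ∫ s in (τ k : ℝ)..τ (k + 1), l * Real.exp (l * (s - t))
        = Real.exp (l * (τ (k + 1) - t)) - Real.exp (l * (τ k - t)) := by
      refine intervalIntegral.integral_eq_sub_of_hasDerivAt
        (f := fun s => Real.exp (l * (s - t))) (fun s _ => ?_)
        ((by fun_prop : Continuous fun s : ℝ => l * Real.exp (l * (s - t))).intervalIntegrable _ _)
      have := (((hasDerivAt_id s).sub_const (t : ℝ)).const_mul l).exp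
      simpa [mul_comm] using this
    have heq : Real.exp (l * (τ (k + 1) - t)) • z (τ (k + 1))
        - Real.exp (l * (τ k - t)) • z (τ k)
        - Real.exp (l * (τ k - t)) • (w (τ (k + 1)) - w (τ k))
        = ∫ s in (τ k : ℝ)..τ (k + 1), H (s, τ (k + 1), τ k) := by
      simp only [H]
      rw [intervalIntegral.integral_sub, intervalIntegral.integral_smul_const,
        intervalIntegral.integral_smul, hexp, hincr, hyz]
      · rw [sub_smul, smul_add, smul_sub, smul_smul,
          mul_comm l (Real.exp (l * (τ k - t)))]
        abel
      · exact Continuous.intervalIntegrable (by fun_prop) _ _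
      · exact Continuous.intervalIntegrable (by fun_prop) _ _
    have hsub := gridPoint_succ_sub t N k
    rw [heq]
    refine (intervalIntegral.norm_integral_le_of_norm_le_const (C := ε / (t + 1))
      fun s hs => ?_).trans_eq ?_
    · rw [Set.uIoc_of_le hle] at hs
      have h0 : (0 : ℝ) ≤ τ k := (τ k).2
      have hs' : s ∈ Set.Icc 0 (t : ℝ) := ⟨h0.trans hs.1.le, hs.2.trans hlast⟩
      have := hHδ (s, τ (k + 1), τ k) ⟨hs', ⟨(τ (k + 1)).2, hlast⟩, h0, hle.trans hlast⟩
        (s, s, s) ⟨hs', hs', hs'⟩ ?_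
      · simp only [H, dist_eq_norm, sub_self, sub_zero] at this
        exact this.le
      · simp only [Prod.dist_eq, dist_self, Real.dist_eq]
        have h1 : |(τ (k + 1) : ℝ) - s| < δ := by
          rw [abs_of_nonneg (by linarith [hs.2])]; linarith [hs.1]
        have h2 : |(τ k : ℝ) - s| < δ := by
          rw [abs_of_nonpos (by linarith [hs.1])]; linarith [hs.2]
        simp [h1, h2]
    · rw [hτ, hsub, abs_of_nonneg (by positivity)]
  have htel := Finset.sum_range_sub (fun k => Real.exp (l * (τ k - t)) • z (τ k)) (N + 1)
  simp only [hτ, gridPoint_last, gridPoint_zero, sub_self, mul_zero, Real.exp_zero, one_smul,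
    NNReal.coe_zero, zero_sub, mul_neg] at htel
  rw [dist_comm, dist_eq_norm, ← htel, ← Finset.sum_sub_distrib]
  refine (norm_sum_le_of_le _ hstep).trans_lt ?_
  rw [Finset.sum_const, Finset.card_range, nsmul_eq_mul]
  push_cast
  rw [mul_comm (ε / _), ← mul_assoc, mul_div_cancel₀ _ hNpos.ne', mul_div_assoc',
    div_lt_iff₀ (by positivity)]
  nlinarith

/-- The Riemann sums of `s ↦ exp (-2 (t - s))` on `[0, t]`. -/
lemma tendsto_sum_exp_sq_mul_increments (t : ℝ≥0) :
    Tendsto (fun N : ℕ => ∑ k ∈ Finset.range (N + 1),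
        Real.exp (gridPoint t N k - t) ^ 2 *
          ((gridPoint t N (k + 1) : ℝ) - gridPoint t N k)) atTop
      (𝓝 ((1 - Real.exp (-2 * t)) / 2)) := by
  -- The function `(1 - e^{-2s})/2` solves `z' = 1 - 2z` with `z 0 = 0`, so the Riemann sum is the
  -- previous lemma driven by `w s = s` with `l = 2`.
  have key := tendsto_sum_exp_smul_increments (E := ℝ) (l := 2)
    (z := fun s => (1 - Real.exp (-2 * s)) / 2) (w := fun s => (s : ℝ)) (by fun_prop) ?_ t
  · simpa [← Real.exp_nat_mul] using key
  · intro s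
    have hcongr : ∫ u in (0 : ℝ)..s, (1 - Real.exp (-2 * (u.toNNReal : ℝ))) / 2
        = ∫ u in (0 : ℝ)..s, (1 - Real.exp (-2 * u)) / 2 := by
      refine intervalIntegral.integral_congr fun u hu => ?_
      rw [Set.uIcc_of_le (show (0 : ℝ) ≤ s from s.2)] at hu
      simp [Real.coe_toNNReal _ hu.1]
    have hint : ∫ u in (0 : ℝ)..s, (1 - Real.exp (-2 * u)) / 2
        = ((s : ℝ) / 2 + Real.exp (-2 * s) / 4) - ((0 : ℝ) / 2 + Real.exp (-2 * 0) / 4) := by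
      refine intervalIntegral.integral_eq_sub_of_hasDerivAt
        (f := fun u => u / 2 + Real.exp (-2 * u) / 4) (fun u _ => ?_)
        (Continuous.intervalIntegrable (by fun_prop) _ _)
      have := ((hasDerivAt_id u).div_const 2).add
        ((((hasDerivAt_id u).const_mul (-2)).exp).div_const 4)
      refine this.congr_deriv ?_
      simp only [id]
      ring
    rw [hcongr, hint]
    simp
    ring

end Pathwise

/-! ### Characteristic function of the Ornstein–Uhlenbeck marginal. -/

section Law

variable {Ω : Type*} [MeasurableSpace Ω] {P : Measure Ω} {n : ℕ}

lemma charFun_sum_smul_increments_real {B : ℝ≥0 → Ω → ℝ} (hB : IsPreBrownianReal B P)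
    {τ : ℕ → ℝ≥0} (hτ : Monotone τ) (c : ℕ → ℝ) (N : ℕ) (x : ℝ) :
    charFun (P.map fun ω => ∑ k ∈ Finset.range N, c k * (B (τ (k + 1)) ω - B (τ k) ω)) x
      = Complex.exp
        (-((x ^ 2 / 2 * ∑ k ∈ Finset.range N, c k ^ 2 * ((τ (k + 1) : ℝ) - τ k) : ℝ) : ℂ)) := by
  have hindep : iIndepFun (fun (k : ℕ) ω => c k * (B (τ (k + 1)) ω - B (τ k) ω)) P :=
    (hB.hasIndepIncrements.nat hτ).comp (fun k y => c k * y) (fun k => by fun_prop)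
  have hmeas (k : ℕ) : AEMeasurable (fun ω => c k * (B (τ (k + 1)) ω - B (τ k) ω)) P :=
    ((hB.aemeasurable _).sub (hB.aemeasurable _)).const_mul _
  rw [iIndepFun.charFun_map_fun_finsetSum_eq_prod
    (X := fun (k : ℕ) ω => c k * (B (τ (k + 1)) ω - B (τ k) ω)) (fun k _ => hmeas k)
    (hindep.restrict _), Finset.prod_apply]
  have hfac (k : ℕ) : charFun (P.map fun ω => c k * (B (τ (k + 1)) ω - B (τ k) ω)) x
      = Complex.exp (-((x ^ 2 / 2 * (c k ^ 2 * ((τ (k + 1) : ℝ) - τ k)) : ℝ) : ℂ)) := by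
    have h := gaussianReal_const_mul (hB.hasLaw_sub (τ (k + 1)) (τ k)) (c k)
    have h' := h.map_eq
    simp only [Pi.sub_apply] at h'
    have hnn : ((nndist (τ (k + 1) : ℝ) (τ k) : ℝ≥0) : ℝ) = (τ (k + 1) : ℝ) - τ k := by
      rw [coe_nndist, Real.dist_eq, abs_of_nonneg]
      exact sub_nonneg.2 (by exact_mod_cast hτ (Nat.le_succ k))
    rw [h', charFun_gaussianReal]
    congr 1
    push_cast [← hnn]
    simp
    ring
  rw [Finset.prod_congr rfl fun k _ => hfac k, ← Complex.exp_sum, Finset.sum_neg_distrib,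
    Finset.mul_sum, Complex.ofReal_sum]

lemma IsBrownianVec.charFun_sum_smul_increments [IsProbabilityMeasure P]
    {B : ℝ≥0 → Ω → EuclideanSpace ℝ (Fin n)}
    (hB : IsBrownianVec B P) {τ : ℕ → ℝ≥0} (hτ : Monotone τ) (c : ℕ → ℝ) (N : ℕ)
    (x : EuclideanSpace ℝ (Fin n)) :
    charFun (P.map fun ω => ∑ k ∈ Finset.range N, c k • (B (τ (k + 1)) ω - B (τ k) ω)) x
      = Complex.exp
        (-((‖x‖ ^ 2 / 2 * ∑ k ∈ Finset.range N, c k ^ 2 * ((τ (k + 1) : ℝ) - τ k) : ℝ) : ℂ)) := by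
  set X : Fin n → Ω → ℝ := fun i ω => ∑ k ∈ Finset.range N, c k * (B (τ (k + 1)) ω i - B (τ k) ω i)
  have hX : (fun ω => ∑ k ∈ Finset.range N, c k • (B (τ (k + 1)) ω - B (τ k) ω))
      = fun ω => WithLp.toLp 2 (X · ω) := by
    ext ω i
    simp [X]
  have hmeas (i : Fin n) : AEMeasurable (X i) P := by
    have (t : ℝ≥0) : AEMeasurable (fun ω => B t ω i) P := (hB.brownian i).aemeasurable t
    exact Finset.aemeasurable_fun_sum _ fun k _ => ((this _).sub (this _)).const_mul _
  have hindep : iIndepFun X P :=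
    hB.indep.comp (fun i (p : ℝ≥0 → ℝ) => ∑ k ∈ Finset.range N, c k * (p (τ (k + 1)) - p (τ k)))
      (fun i => by fun_prop)
  rw [hX, (iIndepFun_iff_charFun_pi hmeas).1 hindep x,
    Finset.prod_congr rfl fun i _ =>
      charFun_sum_smul_increments_real (hB.brownian i).toIsPreBrownianReal hτ c N (x i),
    ← Complex.exp_sum, EuclideanSpace.real_norm_sq_eq, Finset.sum_neg_distrib, Finset.sum_div,
    Finset.sum_mul, Complex.ofReal_sum]

lemma IsBrownianVec.aemeasurable {B : ℝ≥0 → Ω → EuclideanSpace ℝ (Fin n)}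
    (hB : IsBrownianVec B P) (t : ℝ≥0) : AEMeasurable (B t) P := by
  have : AEMeasurable (fun ω i => B t ω i) P :=
    aemeasurable_pi_lambda _ fun i => (hB.brownian i).aemeasurable t
  exact (MeasurableEquiv.toLp 2 (Fin n → ℝ)).measurable.comp_aemeasurable this

/-- Almost surely `Z t` is the limit of `e^{-t} z₀` plus weighted Brownian increments, so no
stochastic integral is needed. These approximations have explicit Gaussian characteristic functions;
dominated convergence handles one side and the Riemann sums of the variance the other. -/
lemma IsOUProcess.charFun_map [IsProbabilityMeasure P]
    {Z B : ℝ≥0 → Ω → EuclideanSpace ℝ (Fin n)} {z₀ : EuclideanSpace ℝ (Fin n)}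
    (hZ : IsOUProcess Z B z₀ P) (t : ℝ≥0) (x : EuclideanSpace ℝ (Fin n)) :
    charFun (P.map (Z t)) x
      = Complex.exp ((inner ℝ (Real.exp (-t) • z₀) x : ℝ) * Complex.I)
        * Complex.exp (-((‖x‖ ^ 2 * ((1 - Real.exp (-2 * t)) / (2 * n)) : ℝ) : ℂ)) := by
  set S : ℕ → Ω → EuclideanSpace ℝ (Fin n) := fun N ω => ∑ k ∈ Finset.range (N + 1),
    (Real.exp (gridPoint t N k - t) * √(2 / (n : ℝ))) •
      (B (gridPoint t N (k + 1)) ω - B (gridPoint t N k) ω) with hS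
  have hSmeas (N : ℕ) : AEMeasurable (S N) P :=
    Finset.aemeasurable_fun_sum _ fun k _ =>
      ((hZ.isBrownianVec.aemeasurable (gridPoint t N (k + 1))).sub
        (hZ.isBrownianVec.aemeasurable (gridPoint t N k))).const_smul
          (Real.exp (gridPoint t N k - t) * √(2 / (n : ℝ)))
  have hlim : ∀ᵐ ω ∂P, Tendsto (fun N => Real.exp (-t) • z₀ + S N ω) atTop (𝓝 (Z t ω)) := by
    filter_upwards [hZ.continuous, hZ.initial, hZ.equation] with ω hc h0 he
    have := tendsto_sum_exp_smul_increments (z := fun s => Z s ω)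
      (w := fun s => √(2 / (n : ℝ)) • B s ω) (l := 1) hc
      (fun s => by rw [one_smul, ← smul_sub]; exact he s) t
    have := this.const_add (Real.exp (-t) • z₀)
    simpa [hS, h0, smul_smul, ← smul_sub] using this
  have hchar (μ : Ω → EuclideanSpace ℝ (Fin n)) (hμ : AEMeasurable μ P) :
      charFun (P.map μ) x = ∫ ω, Complex.exp ((inner ℝ (μ ω) x : ℝ) * Complex.I) ∂P := by
    rw [charFun_apply, integral_map hμ (by fun_prop)]
  have hconv : Tendsto (fun N => charFun (P.map fun ω => Real.exp (-t) • z₀ + S N ω) x) atTop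
      (𝓝 (charFun (P.map (Z t)) x)) := by
    rw [hchar _ (hZ.aemeasurable t)]
    simp_rw [fun N => hchar _ ((hSmeas N).const_add (Real.exp (-t) • z₀))]
    refine tendsto_integral_of_dominated_convergence (fun _ => 1) (fun N => ?_)
      (integrable_const _) (fun N => .of_forall fun ω => ?_) ?_
    · have := (hSmeas N).const_add (Real.exp (-t) • z₀)
      have hm : Measurable fun y : EuclideanSpace ℝ (Fin n) =>
        Complex.exp ((inner ℝ y x : ℝ) * Complex.I) := by fun_prop
      exact (hm.comp_aemeasurable this).aestronglyMeasurable
    · rw [Complex.norm_exp_ofReal_mul_I]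
    · filter_upwards [hlim] with ω hω
      have hcont : Continuous fun y : EuclideanSpace ℝ (Fin n) =>
        Complex.exp ((inner ℝ y x : ℝ) * Complex.I) := by fun_prop
      exact (hcont.tendsto _).comp hω
  refine tendsto_nhds_unique hconv ?_
  have hval (N : ℕ) : charFun (P.map fun ω => Real.exp (-t) • z₀ + S N ω) x
      = Complex.exp ((inner ℝ (Real.exp (-t) • z₀) x : ℝ) * Complex.I)
        * Complex.exp (-((‖x‖ ^ 2 / n * ∑ k ∈ Finset.range (N + 1),
          Real.exp (gridPoint t N k - t) ^ 2 *
            ((gridPoint t N (k + 1) : ℝ) - gridPoint t N k) : ℝ) : ℂ)) := by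
    have hcomp : (P.map fun ω => Real.exp (-t) • z₀ + S N ω)
        = (P.map (S N)).map (fun y => Real.exp (-t) • z₀ + y) := by
      rw [AEMeasurable.map_map_of_aemeasurable (by fun_prop) (hSmeas N)]
      rfl
    rw [hcomp, charFun_map_const_add, hS,
      hZ.isBrownianVec.charFun_sum_smul_increments (gridPoint_mono t N), mul_comm,
      real_inner_comm]
    congr 3
    refine congrArg _ ?_
    rw [Finset.mul_sum, Finset.mul_sum]
    refine Finset.sum_congr rfl fun k _ => ?_
    rw [mul_pow, Real.sq_sqrt (by positivity)]
    ring
  simp_rw [hval]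
  refine Tendsto.const_mul _ ((Complex.continuous_exp.tendsto _).comp ?_)
  refine ((Complex.continuous_ofReal.tendsto _).comp ?_).neg
  have := (tendsto_sum_exp_sq_mul_increments t).const_mul (‖x‖ ^ 2 / n)
  convert this using 2
  ring

end Law

/-! ### Reduction to product Gaussian measures. -/

section ScaledPi

/-- The rescaling `x ↦ x / √n`, from the plain product to the Euclidean space. -/
noncomputable def scaledToLp (n : ℕ) (hn : n ≠ 0) : (Fin n → ℝ) ≃ᵐ EuclideanSpace ℝ (Fin n) :=
  (MeasurableEquiv.toLp 2 (Fin n → ℝ)).trans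
    (MeasurableEquiv.smul₀ ((√(n : ℝ))⁻¹) (by positivity))

lemma charFun_map_scaledToLp {n : ℕ} (hn : n ≠ 0) (m : Fin n → ℝ) (v : ℝ≥0)
    (x : EuclideanSpace ℝ (Fin n)) :
    charFun ((Measure.pi fun i => gaussianReal (m i) v).map (scaledToLp n hn)) x
      = Complex.exp ((((√(n : ℝ))⁻¹ * ∑ i, m i * x i : ℝ) : ℂ) * Complex.I)
        * Complex.exp (-((‖x‖ ^ 2 * (v / (2 * n)) : ℝ) : ℂ)) := by
  have hcomp : (Measure.pi fun i => gaussianReal (m i) v).map (scaledToLp n hn)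
      = ((Measure.pi fun i => gaussianReal (m i) v).map (WithLp.toLp 2)).map
        ((√(n : ℝ))⁻¹ • ·) := by
    rw [Measure.map_map (by fun_prop) (by fun_prop)]
    rfl
  rw [hcomp, charFun_map_smul, charFun_pi]
  simp_rw [charFun_gaussianReal]
  rw [← Complex.exp_sum, ← Complex.exp_add]
  congr 1
  have hsq : (√(n : ℝ))⁻¹ ^ 2 = 1 / n := by rw [inv_pow, Real.sq_sqrt (by positivity), one_div]
  have h2 (i : Fin n) : (((√(n : ℝ))⁻¹ • x) i * m i : ℂ) * Complex.I
      - v * ((((√(n : ℝ))⁻¹ • x) i : ℝ) : ℂ) ^ 2 / 2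
      = (((√(n : ℝ))⁻¹ * (m i * x i) : ℝ) : ℂ) * Complex.I
        - ((x i ^ 2 * (v / (2 * n)) : ℝ) : ℂ) := by
    have : (v : ℝ) * ((√(n : ℝ))⁻¹ * x i) ^ 2 / 2 = x i ^ 2 * (v / (2 * n)) := by
      rw [mul_pow, hsq]; field_simp
    rw [← this]
    simp
    ring
  rw [Finset.sum_congr rfl fun i _ => h2 i, Finset.sum_sub_distrib, ← Finset.sum_mul,
    ← Complex.ofReal_sum, ← Complex.ofReal_sum, ← Finset.mul_sum, ← Finset.sum_mul,
    EuclideanSpace.real_norm_sq_eq, sub_eq_add_neg]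

/-- The same bijective rescaling carries the standard product measure to the invariant law, so the
comparison can be made coordinate by coordinate. -/
lemma IsOUProcess.map_eq {Ω : Type*} [MeasurableSpace Ω] {P : Measure Ω} [IsProbabilityMeasure P]
    {n : ℕ} (hn : n ≠ 0) {Z B : ℝ≥0 → Ω → EuclideanSpace ℝ (Fin n)}
    {z₀ : EuclideanSpace ℝ (Fin n)} (hZ : IsOUProcess Z B z₀ P) (t : ℝ≥0) :
    P.map (Z t) = (Measure.pi fun i => gaussianReal (√(n : ℝ) * Real.exp (-t) * z₀ i)
      (1 - Real.exp (-2 * t)).toNNReal).map (scaledToLp n hn) := by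
  have := Measure.isProbabilityMeasure_map (hZ.aemeasurable t)
  have := Measure.isProbabilityMeasure_map (μ := Measure.pi fun i =>
    gaussianReal (√(n : ℝ) * Real.exp (-t) * z₀ i) (1 - Real.exp (-2 * t)).toNNReal)
    (scaledToLp n hn).measurable.aemeasurable
  refine Measure.ext_of_charFun (funext fun x => ?_)
  have hv : 0 ≤ 1 - Real.exp (-2 * t) := by
    have : Real.exp (-2 * t) ≤ 1 := Real.exp_le_one_iff.2 (by have := t.2; linarith)
    linarith
  rw [hZ.charFun_map, charFun_map_scaledToLp, Real.coe_toNNReal _ hv]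
  congr 4
  rw [PiLp.inner_apply, Finset.mul_sum]
  refine Finset.sum_congr rfl fun i _ => ?_
  have : √(n : ℝ) ≠ 0 := by positivity
  simp
  field_simp

lemma ouInvariantLaw_eq {n : ℕ} (hn : n ≠ 0) :
    ouInvariantLaw n = (Measure.pi fun _ => gaussianReal 0 1).map (scaledToLp n hn) := by
  have := Measure.isProbabilityMeasure_map (μ := Measure.pi fun _ : Fin n => gaussianReal 0 1)
    (scaledToLp n hn).measurable.aemeasurable
  have hS : ((1 / (n : ℝ)) • (1 : Matrix (Fin n) (Fin n) ℝ)).PosSemidef :=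
    Matrix.PosSemidef.one.smul (by positivity)
  rw [ouInvariantLaw]
  refine Measure.ext_of_charFun (funext fun x => ?_)
  rw [charFun_multivariateGaussian hS, charFun_map_scaledToLp hn (fun _ => 0) 1,
    EuclideanSpace.real_norm_sq_eq, ← Complex.exp_add]
  congr 1
  simp [dotProduct, Matrix.smul_mulVec, Finset.sum_mul, Finset.sum_div]
  refine Finset.sum_congr rfl fun i _ => ?_
  field_simp

end ScaledPi

/-! ### Total variation through the log-likelihood ratio. -/

section TotalVariation

variable {α β : Type*} [MeasurableSpace α] [MeasurableSpace β]

lemma tvDistance_map_measurableEquiv (μ ν : Measure α) (e : α ≃ᵐ β) :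
    tvDistance (μ.map e) (ν.map e) = tvDistance μ ν := by
  unfold tvDistance
  refine Function.Surjective.iSup_congr
    (fun A : {A : Set β // MeasurableSet A} =>
      (⟨e ⁻¹' A.1, e.measurable A.2⟩ : {A : Set α // MeasurableSet A})) (fun A => ?_) fun A => ?_
  · exact ⟨⟨e.symm ⁻¹' A.1, e.symm.measurable A.2⟩, Subtype.ext (by ext; simp)⟩
  · simp [Measure.real, e.map_apply]

variable {μ ν : Measure α} [IsProbabilityMeasure μ] {f : α → ℝ}

lemma integrable_exp_of_withDensity (hf : Measurable f)
    (h : μ = ν.withDensity fun x => ENNReal.ofReal (Real.exp (f x))) :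
    Integrable (fun x => Real.exp (f x)) ν := by
  refine ⟨by fun_prop, ?_⟩
  rw [hasFiniteIntegral_iff_ofReal (.of_forall fun x => (Real.exp_pos _).le)]
  have := congr($h Set.univ)
  rw [withDensity_apply _ .univ, setLIntegral_univ, measure_univ] at this
  simp [← this]

variable [IsProbabilityMeasure ν]

lemma sub_measureReal_eq_setIntegral (hf : Measurable f)
    (h : μ = ν.withDensity fun x => ENNReal.ofReal (Real.exp (f x))) {A : Set α}
    (hA : MeasurableSet A) :
    ν.real A - μ.real A = ∫ x in A, (1 - Real.exp (f x)) ∂ν := by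
  have hi := integrable_exp_of_withDensity hf h
  rw [integral_sub (integrable_const _) hi.integrableOn]
  congr 1
  · simp
  · rw [Measure.real, h, withDensity_apply _ hA,
      integral_eq_lintegral_of_nonneg_ae (.of_forall fun x => (Real.exp_pos _).le) (by fun_prop)]

lemma integral_max_one_sub_exp (hf : Measurable f)
    (h : μ = ν.withDensity fun x => ENNReal.ofReal (Real.exp (f x))) :
    ∫ x, max (1 - Real.exp (f x)) 0 ∂ν = ν.real {x | f x < 0} - μ.real {x | f x < 0} := by
  have hA : MeasurableSet {x | f x < 0} := measurableSet_lt hf measurable_const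
  rw [sub_measureReal_eq_setIntegral hf h hA, ← integral_indicator hA]
  congr 1
  ext x
  by_cases hx : f x < 0
  · rw [Set.indicator_of_mem (show x ∈ {x | f x < 0} from hx), max_eq_left]
    have := Real.exp_le_one_iff.2 hx.le
    linarith
  · rw [Set.indicator_of_notMem (show x ∉ {x | f x < 0} from hx), max_eq_right]
    have := Real.one_le_exp (not_lt.1 hx)
    linarith

/-- The difference `ν A - μ A` is the integral of `1 - e^f` over `A`, hence is largest on `{f < 0}`;
passing to complements controls the opposite sign. -/
lemma tvDistance_eq_integral (hf : Measurable f)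
    (h : μ = ν.withDensity fun x => ENNReal.ofReal (Real.exp (f x))) :
    tvDistance μ ν = ∫ x, max (1 - Real.exp (f x)) 0 ∂ν := by
  have hi : Integrable (fun x => 1 - Real.exp (f x)) ν :=
    (integrable_const _).sub (integrable_exp_of_withDensity hf h)
  have hle {A : Set α} (hA : MeasurableSet A) :
      ν.real A - μ.real A ≤ ∫ x, max (1 - Real.exp (f x)) 0 ∂ν := by
    rw [sub_measureReal_eq_setIntegral hf h hA]
    refine (setIntegral_mono hi.integrableOn hi.pos_part.integrableOn
      fun x => le_max_left _ _).trans (setIntegral_le_integral hi.pos_part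
        (.of_forall fun x => le_max_right _ _))
  have habs (A : {A : Set α // MeasurableSet A}) :
      |μ.real A.1 - ν.real A.1| ≤ ∫ x, max (1 - Real.exp (f x)) 0 ∂ν := by
    refine abs_le.2 ⟨?_, ?_⟩
    · linarith [hle A.2]
    · have := hle A.2.compl
      rw [probReal_compl_eq_one_sub A.2, probReal_compl_eq_one_sub A.2] at this
      linarith
  refine le_antisymm (ciSup_le habs) ?_
  rw [integral_max_one_sub_exp hf h]
  refine le_ciSup_of_le ⟨_, Set.forall_mem_range.2 habs⟩
    ⟨{x | f x < 0}, measurableSet_lt hf measurable_const⟩ ?_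
  rw [abs_sub_comm]
  exact le_abs_self _

end TotalVariation

/-! ### Densities of Gaussian and product measures. -/

section Densities

lemma gaussianReal_eq_withDensity_gaussianReal {m m' : ℝ} {v v' : ℝ≥0} (hv : v ≠ 0) (hv' : v' ≠ 0)
    {f : ℝ → ℝ} (hf : Measurable f)
    (h : ∀ x, gaussianPDFReal m v x = gaussianPDFReal m' v' x * Real.exp (f x)) :
    gaussianReal m v
      = (gaussianReal m' v').withDensity fun x => ENNReal.ofReal (Real.exp (f x)) := by
  rw [gaussianReal_of_var_ne_zero _ hv, gaussianReal_of_var_ne_zero _ hv',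
    ← withDensity_mul _ (measurable_gaussianPDF _ _) (by fun_prop)]
  congr 1
  ext x
  rw [Pi.mul_apply, gaussianPDF, gaussianPDF, h,
    ENNReal.ofReal_mul (gaussianPDFReal_nonneg _ _ _)]

/-- On a box the indicator times the product density factors over coordinates, which are independent
under `Measure.pi μ`; boxes determine the product measure. -/
lemma pi_withDensity {ι : Type*} [Fintype ι] {E : ι → Type*} [∀ i, MeasurableSpace (E i)]
    (μ : ∀ i, Measure (E i)) [∀ i, IsProbabilityMeasure (μ i)] {f : ∀ i, E i → ℝ≥0∞}
    (hf : ∀ i, Measurable (f i)) [∀ i, SigmaFinite ((μ i).withDensity (f i))] :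
    Measure.pi (fun i => (μ i).withDensity (f i))
      = (Measure.pi μ).withDensity fun x => ∏ i, f i (x i) := by
  classical
  refine Measure.pi_eq fun s hs => ?_
  rw [withDensity_apply _ (.univ_pi hs), ← lintegral_indicator (.univ_pi hs)]
  have hind (x : ∀ i, E i) : (Set.univ.pi s).indicator (fun x => ∏ i, f i (x i)) x
      = ∏ i, (s i).indicator (f i) (x i) := by
    by_cases hx : x ∈ Set.univ.pi s
    · rw [Set.indicator_of_mem hx]
      exact Finset.prod_congr rfl fun i _ => (Set.indicator_of_mem (hx i trivial) _).symm
    · rw [Set.indicator_of_notMem hx]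
      simp only [Set.mem_pi, Set.mem_univ, true_implies, not_forall] at hx
      obtain ⟨i, hi⟩ := hx
      exact (Finset.prod_eq_zero (Finset.mem_univ i) (Set.indicator_of_notMem hi _)).symm
  have hmeas (i : ι) : Measurable ((s i).indicator (f i)) := (hf i).indicator (hs i)
  simp_rw [hind]
  rw [lintegral_prod_eq_prod_lintegral_of_indepFun Finset.univ
    (fun i (x : ∀ i, E i) => (s i).indicator (f i) (x i))
    (iIndepFun_pi fun i => (hmeas i).aemeasurable)
    fun i => (hmeas i).comp (measurable_pi_apply i)]
  refine Finset.prod_congr rfl fun i _ => ?_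
  rw [withDensity_apply _ (hs i), ← lintegral_indicator (hs i),
    (measurePreserving_eval μ i).lintegral_comp (hmeas i)]

end Densities

/-! ### The error function and the Gaussian shift experiment. -/

section ErrorFunction

lemma errorFn_eq_gaussianReal (u : ℝ) :
    errorFn u = (gaussianReal 0 1).real {x : ℝ | |x| ≤ √2 * u} := by
  have hm (v : ℝ) : MeasurableSet {x : ℝ | |x| ≤ v} :=
    measurableSet_le (by fun_prop) measurable_const
  have h2 : (0 : ℝ) < √2 := by positivity
  rw [Measure.real, gaussianReal_apply_eq_integral 0 one_ne_zero,
    ENNReal.toReal_ofReal (integral_nonneg fun x => gaussianPDFReal_nonneg _ _ _), errorFn,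
    ← integral_indicator (hm _), ← integral_indicator (hm _), ← integral_const_mul]
  have hscale := Measure.integral_comp_mul_left
    ({x : ℝ | |x| ≤ √2 * u}.indicator (gaussianPDFReal 0 1)) (√2)
  rw [abs_of_pos (inv_pos.2 h2), smul_eq_mul, inv_mul_eq_div, eq_div_iff h2.ne'] at hscale
  rw [← hscale, ← integral_mul_const]
  congr 1
  ext x
  have hiff : |√2 * x| ≤ √2 * u ↔ |x| ≤ u := by
    rw [abs_mul, abs_of_pos h2, mul_le_mul_iff_right₀ h2]
  by_cases hx : |x| ≤ u
  · rw [Set.indicator_of_mem (show x ∈ {x | |x| ≤ u} from hx),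
      Set.indicator_of_mem (show √2 * x ∈ {x | |x| ≤ √2 * u} from hiff.2 hx), gaussianPDFReal]
    have : √(2 * Real.pi) = √2 * √Real.pi := Real.sqrt_mul (by norm_num) _
    simp [mul_pow, this]
    field_simp
  · rw [Set.indicator_of_notMem (show x ∉ {x | |x| ≤ u} from hx),
      Set.indicator_of_notMem (show √2 * x ∉ {x | |x| ≤ √2 * u} from fun h => hx (hiff.1 h))]
    simp

/-- The limiting total variation distance in a Gaussian shift experiment. -/
lemma integral_max_one_sub_exp_gaussianReal {s : ℝ} (hs : 0 < s) :
    ∫ y, max (1 - Real.exp y) 0 ∂(gaussianReal (-(s ^ 2 / 2)) (s ^ 2).toNNReal)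
      = errorFn (s / (2 * √2)) := by
  have hv : (s ^ 2).toNNReal ≠ 0 := by simpa using hs.ne'
  have hvs : (((s ^ 2).toNNReal : ℝ≥0) : ℝ) = s ^ 2 := Real.coe_toNNReal _ (by positivity)
  -- Tilting `N(-s²/2, s²)` by `e^y` moves its mean to `s²/2`, so the integral is a difference of
  -- two normal probabilities of `{y < 0}`, namely `P(-s/2 ≤ X < s/2)` for standard `X`.
  have hdens : gaussianReal (s ^ 2 / 2) (s ^ 2).toNNReal
      = (gaussianReal (-(s ^ 2 / 2)) (s ^ 2).toNNReal).withDensity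
        fun y => ENNReal.ofReal (Real.exp (id y)) := by
    refine gaussianReal_eq_withDensity_gaussianReal hv hv measurable_id fun y => ?_
    rw [gaussianPDFReal, gaussianPDFReal, mul_assoc _ (Real.exp _), ← Real.exp_add, hvs]
    congr 2
    simp only [id]
    field_simp
    ring
  have hstd (m : ℝ) : (gaussianReal m (s ^ 2).toNNReal).real {y | id y < 0}
      = (gaussianReal 0 1).real (Set.Iio (-m / s)) := by
    have hlaw : gaussianReal m (s ^ 2).toNNReal = (gaussianReal 0 1).map fun x => m + s * x := by
      have h1 := gaussianReal_map_const_mul (μ := 0) (v := 1) s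
      have h2 := gaussianReal_map_const_add (μ := s * 0) (v := NNReal.mk (s ^ 2) (sq_nonneg s) * 1) m
      rw [← h1, Measure.map_map (by fun_prop) (by fun_prop)] at h2
      rw [show (fun x => m + s * x) = (fun x => m + x) ∘ fun x => s * x from rfl, h2]
      congr 1
      · simp
      · exact NNReal.eq (by simp [hvs])
    rw [hlaw, map_measureReal_apply (by fun_prop) (measurableSet_lt measurable_id measurable_const)]
    congr 1
    ext x
    simp only [id, Set.mem_preimage, Set.mem_ofPred_eq, Set.mem_Iio, lt_div_iff₀ hs]
    constructor <;> intro <;> linarith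
  have := integral_max_one_sub_exp measurable_id hdens
  simp only [hstd] at this
  simp only [id] at this
  rw [this, errorFn_eq_gaussianReal]
  have hsub : Set.Iio (-(s ^ 2 / 2) / s) ⊆ Set.Iio (-(-(s ^ 2 / 2)) / s) := by
    refine Set.Iio_subset_Iio ?_
    gcongr
    nlinarith
  rw [← measureReal_sdiff hsub measurableSet_Iio]
  have : NullSingletonClass (gaussianReal 0 1) := nullSingletonClass_gaussianReal one_ne_zero
  refine measureReal_congr ?_
  have hset : {x : ℝ | |x| ≤ √2 * (s / (2 * √2))} = Set.Icc (-(s / 2)) (s / 2) := by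
    have : √2 * (s / (2 * √2)) = s / 2 := by field_simp
    ext x
    rw [Set.mem_ofPred_eq, this, abs_le, Set.mem_Icc]
  have hset' : Set.Iio (-(-(s ^ 2 / 2)) / s) \ Set.Iio (-(s ^ 2 / 2) / s)
      = Set.Ico (-(s / 2)) (s / 2) := by
    have h1 : -(-(s ^ 2 / 2)) / s = s / 2 := by field_simp
    have h2 : -(s ^ 2 / 2) / s = -(s / 2) := by field_simp
    rw [h1, h2]
    ext x
    simp [and_comm]
  rw [hset, hset']
  exact Ico_ae_eq_Icc

end ErrorFunction

/-! ### The Gaussian log-likelihood ratio and its characteristic function. -/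

section LogLikelihood

/-- The log-likelihood ratio of `N(m, 1 / (1 + d))` with respect to `N(0, 1)`. -/
noncomputable def gaussianLogRatio (d m x : ℝ) : ℝ :=
  Real.log (1 + d) / 2 - d / 2 * x ^ 2 + (1 + d) * m * x - (1 + d) * m ^ 2 / 2

@[fun_prop]
lemma measurable_gaussianLogRatio (d m : ℝ) : Measurable (gaussianLogRatio d m) := by
  unfold gaussianLogRatio
  fun_prop

lemma gaussianReal_eq_withDensity_gaussianLogRatio {d : ℝ} (hd : 0 ≤ d) (m : ℝ) :
    gaussianReal m ((1 + d)⁻¹).toNNReal = (gaussianReal 0 1).withDensity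
      fun x => ENNReal.ofReal (Real.exp (gaussianLogRatio d m x)) := by
  have hd' : 0 < 1 + d := by linarith
  have hv : (((1 + d)⁻¹).toNNReal : ℝ) = (1 + d)⁻¹ := Real.coe_toNNReal _ (by positivity)
  refine gaussianReal_eq_withDensity_gaussianReal (by simpa using hd') one_ne_zero (by fun_prop)
    fun x => ?_
  rw [gaussianPDFReal, gaussianPDFReal, hv, mul_assoc _ (Real.exp _), ← Real.exp_add]
  have hlog : Real.exp (Real.log (1 + d) / 2) = √(1 + d) := by
    rw [Real.sqrt_eq_rpow, Real.rpow_def_of_pos hd']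
    ring_nf
  have hsplit : -(x - 0) ^ 2 / (2 * ((1 : ℝ≥0) : ℝ)) + gaussianLogRatio d m x
      = Real.log (1 + d) / 2 + -(x - m) ^ 2 / (2 * (1 + d)⁻¹) := by
    simp only [gaussianLogRatio, NNReal.coe_one]
    field_simp
    ring
  rw [hsplit, Real.exp_add, hlog, Real.sqrt_mul (by positivity) (1 + d)⁻¹, Real.sqrt_inv]
  have : 0 < √(1 + d) := by positivity
  have : 0 < √(2 * Real.pi) := by positivity
  simp
  field_simp

variable {ι : Type*} [Fintype ι]

lemma pi_gaussianReal_eq_withDensity {d : ℝ} (hd : 0 ≤ d) (m : ι → ℝ) :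
    Measure.pi (fun i => gaussianReal (m i) ((1 + d)⁻¹).toNNReal)
      = (Measure.pi fun _ => gaussianReal 0 1).withDensity
        fun x => ENNReal.ofReal (Real.exp (∑ i, gaussianLogRatio d (m i) (x i))) := by
  have hsf (i : ι) : SigmaFinite ((gaussianReal 0 1).withDensity
      fun x => ENNReal.ofReal (Real.exp (gaussianLogRatio d (m i) x))) := by
    rw [← gaussianReal_eq_withDensity_gaussianLogRatio hd]
    infer_instance
  simp_rw [fun i => gaussianReal_eq_withDensity_gaussianLogRatio hd (m i)]
  rw [pi_withDensity _ (fun i => by fun_prop)]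
  congr 1
  ext x
  rw [Real.exp_sum, ENNReal.ofReal_prod_of_nonneg fun i _ => (Real.exp_pos _).le]

lemma charFun_map_gaussianLogRatio (d m u : ℝ) :
    charFun ((gaussianReal 0 1).map (gaussianLogRatio d m)) u
      = Complex.exp ((u * Complex.I * Real.log (1 + d) - Complex.log (1 + u * Complex.I * d)) / 2
        - (m ^ 2 : ℝ) * ((1 + d) / 2 *
          (u * Complex.I + u ^ 2 * (1 + d) / (1 + u * Complex.I * d)))) := by
  set w : ℂ := 1 + u * Complex.I * d with hw
  have hre : w.re = 1 := by simp [hw]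
  have hw0 : w ≠ 0 := fun h => by simp [h] at hre
  -- Since `w` has real part `1`, it avoids the branch cut and `log w⁻¹ = -log w` for the principal
  -- logarithm.
  have harg : w.arg ≠ Real.pi := by
    intro h
    have := Complex.arg_eq_pi_iff.1 h
    linarith [this.1]
  rw [charFun_apply_real, integral_map (by fun_prop) (by fun_prop),
    integral_gaussianReal_eq_integral_smul one_ne_zero]
  have hint (x : ℝ) : gaussianPDFReal 0 1 x •
      Complex.exp (u * (gaussianLogRatio d m x : ℝ) * Complex.I)
      = ((√(2 * Real.pi))⁻¹ : ℝ) * Complex.exp ((-w / 2) * x ^ 2 + (u * Complex.I * (1 + d) * m) * x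
        + u * Complex.I * (Real.log (1 + d) / 2 - (1 + d) * m ^ 2 / 2)) := by
    rw [gaussianPDFReal, Complex.real_smul, Complex.ofReal_mul, mul_assoc, Complex.ofReal_exp,
      ← Complex.exp_add]
    congr 2
    · simp
    · simp only [gaussianLogRatio, hw]
      push_cast
      ring
  have hb : (-w / 2).re < 0 := by
    have : (-w / 2).re = -w.re / 2 := by simp
    rw [this, hre]
    norm_num
  simp_rw [hint]
  rw [integral_const_mul, integral_cexp_quadratic hb]
  have hpow : (Real.pi / -(-w / 2) : ℂ) ^ (1 / 2 : ℂ)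
      = (√(2 * Real.pi) : ℝ) * Complex.exp (-Complex.log w / 2) := by
    have h1 : (Real.pi / -(-w / 2) : ℂ) = ((2 * Real.pi : ℝ) : ℂ) * w⁻¹ := by
      push_cast
      field_simp
    have hpi : (0 : ℝ) < 2 * Real.pi := by positivity
    have hsqrt : Real.exp (Real.log (2 * Real.pi) / 2) = √(2 * Real.pi) := by
      rw [Real.sqrt_eq_rpow, Real.rpow_def_of_pos hpi]
      ring_nf
    rw [h1, Complex.cpow_def_of_ne_zero (mul_ne_zero (by exact_mod_cast hpi.ne') (inv_ne_zero hw0)),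
      Complex.log_ofReal_mul hpi (inv_ne_zero hw0), Complex.log_inv _ harg, ← hsqrt,
      Complex.ofReal_exp, ← Complex.exp_add]
    congr 1
    push_cast
    ring
  have hsq : ((√(2 * Real.pi))⁻¹ : ℝ) * ((√(2 * Real.pi) : ℝ) : ℂ) = 1 := by
    rw [← Complex.ofReal_mul, inv_mul_cancel₀ (by positivity), Complex.ofReal_one]
  rw [hpow, ← mul_assoc, ← mul_assoc, hsq, one_mul, ← Complex.exp_add]
  congr 1
  have hI : Complex.I ^ 2 = -1 := Complex.I_sq
  push_cast
  field_simp
  ring_nf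
  simp only [hI]
  ring

lemma charFun_map_sum_gaussianLogRatio (d : ℝ) (m : ι → ℝ) (u : ℝ) :
    charFun ((Measure.pi fun _ : ι => gaussianReal 0 1).map
        fun x => ∑ i, gaussianLogRatio d (m i) (x i)) u
      = Complex.exp (Fintype.card ι *
          (u * Complex.I * Real.log (1 + d) - Complex.log (1 + u * Complex.I * d)) / 2
        - (∑ i, m i ^ 2 : ℝ) * ((1 + d) / 2 *
          (u * Complex.I + u ^ 2 * (1 + d) / (1 + u * Complex.I * d)))) := by
  have hpi : (Measure.pi fun _ : ι => gaussianReal 0 1).map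
      (fun x => ∑ i, gaussianLogRatio d (m i) (x i))
      = (Measure.pi fun i => (gaussianReal 0 1).map (gaussianLogRatio d (m i))).map
        fun y => ∑ i, y i := by
    rw [← Measure.pi_map_pi fun i => by fun_prop, Measure.map_map (by fun_prop) (by fun_prop)]
    rfl
  have hprob (i : ι) : IsProbabilityMeasure ((gaussianReal 0 1).map (gaussianLogRatio d (m i))) :=
    Measure.isProbabilityMeasure_map (by fun_prop)
  rw [hpi, charFun_map_sum_pi_eq_prod, Finset.prod_apply]
  simp_rw [charFun_map_gaussianLogRatio]
  rw [← Complex.exp_sum, Finset.sum_sub_distrib, ← Finset.sum_mul, Finset.sum_const,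
    Finset.card_univ, nsmul_eq_mul, Complex.ofReal_sum,
    mul_div_assoc (Fintype.card ι : ℂ)]

end LogLikelihood

/-! ### Asymptotic normality and convergence of the distance. -/

section Limit

/-- The Taylor remainder is `O((k d)³)`, and `n d³ = (n d²) d` tends to zero. -/
lemma tendsto_mul_log_remainder {d : ℕ → ℝ} {L : ℝ} (hd : Tendsto d atTop (𝓝 0))
    (hL : Tendsto (fun n : ℕ => (n : ℝ) * d n ^ 2) atTop (𝓝 L)) (k : ℂ) :
    Tendsto (fun n : ℕ => (n : ℂ) * (Complex.log (1 + k * d n)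
      - (k * d n - (k * d n) ^ 2 / 2))) atTop (𝓝 0) := by
  have hkd : Tendsto (fun n => k * (d n : ℂ)) atTop (𝓝 0) := by
    have := ((Complex.continuous_ofReal.tendsto 0).comp hd).const_mul k
    simpa using this
  have hO := (Complex.log_sub_logTaylor_isBigO 2).comp_tendsto hkd
  have hO' := (Asymptotics.isBigO_refl (fun n : ℕ => (n : ℂ)) atTop).mul hO
  have hz : Tendsto (fun n : ℕ => (n : ℂ) * (k * (d n : ℂ)) ^ 3) atTop (𝓝 0) := by
    have h1 := (Complex.continuous_ofReal.tendsto _).comp hL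
    have := (h1.mul hkd).const_mul (k ^ 2)
    simp only [mul_zero] at this
    refine this.congr fun n => ?_
    simp only [Function.comp_apply]
    push_cast
    ring
  refine (hO'.trans_tendsto hz).congr fun n => ?_
  simp [Complex.logTaylor_succ, Complex.logTaylor_zero]
  ring_nf
  simp

/-- The first-order terms of the two logarithms cancel, and `n` times the second-order ones
converges because `n d² → L`. The means enter only through the sum of their squares, so no condition
on individual coordinates is required. -/
lemma tendsto_charFun_map_sum_gaussianLogRatio {m : ∀ n : ℕ, Fin n → ℝ} {d : ℕ → ℝ} {L M : ℝ}
    (hd0 : ∀ n, 0 ≤ d n) (hd : Tendsto d atTop (𝓝 0))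
    (hL : Tendsto (fun n : ℕ => (n : ℝ) * d n ^ 2) atTop (𝓝 L))
    (hM : Tendsto (fun n => ∑ i, m n i ^ 2) atTop (𝓝 M)) (u : ℝ) :
    Tendsto (fun n => charFun ((Measure.pi fun _ : Fin n => gaussianReal 0 1).map
        fun x => ∑ i, gaussianLogRatio (d n) (m n i) (x i)) u) atTop
      (𝓝 (Complex.exp (-((L / 2 + M) / 2 : ℝ) * (u * Complex.I + u ^ 2)))) := by
  simp_rw [fun n => charFun_map_sum_gaussianLogRatio (d n) (m n) u]
  refine (Complex.continuous_exp.tendsto _).comp ?_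
  have hdC : Tendsto (fun n => (d n : ℂ)) atTop (𝓝 0) := by
    exact (Complex.continuous_ofReal.tendsto' 0 0 Complex.ofReal_zero).comp hd
  have hMC : Tendsto (fun n => ((∑ i, m n i ^ 2 : ℝ) : ℂ)) atTop (𝓝 M) :=
    (Complex.continuous_ofReal.tendsto _).comp hM
  have hLC : Tendsto (fun n : ℕ => (n : ℂ) * (d n : ℂ) ^ 2) atTop (𝓝 L) := by
    have := (Complex.continuous_ofReal.tendsto _).comp hL
    refine this.congr fun n => ?_
    simp
  have h1 : Tendsto (fun n : ℕ => (n : ℂ) * (u * Complex.I * Real.log (1 + d n)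
      - Complex.log (1 + u * Complex.I * d n)) / 2) atTop
      (𝓝 (L * ((-(u * Complex.I) - u ^ 2) / 2) / 2)) := by
    have hr1 := (tendsto_mul_log_remainder hd hL 1).const_mul (u * Complex.I)
    have hr2 := tendsto_mul_log_remainder hd hL (u * Complex.I)
    have := (((hLC.mul_const ((-(u * Complex.I) - u ^ 2) / 2)).add hr1).sub hr2).div_const 2
    simp only [mul_zero, add_zero, sub_zero] at this
    refine this.congr fun n => ?_
    have hlog : (Real.log (1 + d n) : ℂ) = Complex.log (1 + d n) := by
      rw [Complex.ofReal_log (by linarith [hd0 n])]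
      simp
    have hI : Complex.I ^ 2 = -1 := Complex.I_sq
    rw [hlog]
    ring_nf
    simp only [hI]
    ring
  have h2 : Tendsto (fun n => (1 + (d n : ℂ)) / 2 *
      (u * Complex.I + u ^ 2 * (1 + (d n : ℂ)) / (1 + u * Complex.I * d n))) atTop
      (𝓝 (1 / 2 * (u * Complex.I + u ^ 2))) := by
    have hone := hdC.const_add 1
    have hden := (hdC.const_mul (u * Complex.I)).const_add 1
    simp only [mul_zero, add_zero] at hone hden
    have := (hone.div_const 2).mul
      (((hone.const_mul ((u : ℂ) ^ 2)).div hden one_ne_zero).const_add (u * Complex.I))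
    simpa using this
  have := h1.sub (hMC.mul h2)
  simp only [Fintype.card_fin]
  convert this using 2
  push_cast
  ring

lemma tendsto_integral_max_one_sub_exp {μ : ℕ → ProbabilityMeasure ℝ} {μ₀ : ProbabilityMeasure ℝ}
    (h : Tendsto μ atTop (𝓝 μ₀)) :
    Tendsto (fun n => ∫ y, max (1 - Real.exp y) 0 ∂(μ n : Measure ℝ)) atTop
      (𝓝 (∫ y, max (1 - Real.exp y) 0 ∂(μ₀ : Measure ℝ))) := by
  have hc : Continuous fun y : ℝ => max (1 - Real.exp y) 0 := by fun_prop
  have hb (y : ℝ) : ‖max (1 - Real.exp y) 0‖ ≤ 1 := by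
    rw [Real.norm_of_nonneg (le_max_right _ _)]
    exact max_le (by linarith [Real.exp_pos y]) zero_le_one
  exact ProbabilityMeasure.tendsto_iff_forall_integral_tendsto.1 h
    (BoundedContinuousFunction.ofNormedAddCommGroup _ hc 1 hb)

/-- If the log-likelihood ratios are asymptotically `N(-s²/2, s²)`, then the total variation
distances converge to the one of the Gaussian shift experiment. -/
lemma tendsto_tvDistance_of_tendsto_charFun {α : ℕ → Type*} [∀ n, MeasurableSpace (α n)]
    {μ ν : ∀ n, Measure (α n)} [∀ n, IsProbabilityMeasure (μ n)] [∀ n, IsProbabilityMeasure (ν n)]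
    {f : ∀ n, α n → ℝ} (hf : ∀ n, Measurable (f n))
    (hμ : ∀ n, μ n = (ν n).withDensity fun x => ENNReal.ofReal (Real.exp (f n x)))
    {s : ℝ} (hs : 0 < s)
    (h : ∀ u : ℝ, Tendsto (fun n => charFun ((ν n).map (f n)) u) atTop
      (𝓝 (Complex.exp (-(s ^ 2 / 2 : ℝ) * (u * Complex.I + u ^ 2))))) :
    Tendsto (fun n => tvDistance (μ n) (ν n)) atTop (𝓝 (errorFn (s / (2 * √2)))) := by
  have hprob (n : ℕ) : IsProbabilityMeasure ((ν n).map (f n)) :=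
    Measure.isProbabilityMeasure_map (hf n).aemeasurable
  have hchar (u : ℝ) : charFun (gaussianReal (-(s ^ 2 / 2)) (s ^ 2).toNNReal) u
      = Complex.exp (-(s ^ 2 / 2 : ℝ) * (u * Complex.I + u ^ 2)) := by
    rw [charFun_gaussianReal, Real.coe_toNNReal _ (by positivity)]
    congr 1
    push_cast
    ring
  let γ : ProbabilityMeasure ℝ := ⟨gaussianReal (-(s ^ 2 / 2)) (s ^ 2).toNNReal, inferInstance⟩
  let law (n : ℕ) : ProbabilityMeasure ℝ := ⟨(ν n).map (f n), hprob n⟩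
  have hweak : Tendsto law atTop (𝓝 γ) :=
    ProbabilityMeasure.tendsto_of_tendsto_charFun fun u => (hchar u).symm ▸ h u
  rw [← integral_max_one_sub_exp_gaussianReal hs]
  refine (tendsto_integral_max_one_sub_exp hweak).congr fun n => ?_
  rw [tvDistance_eq_integral (hf n) (hμ n)]
  exact integral_map (hf n).aemeasurable (Measurable.aestronglyMeasurable (by fun_prop))

theorem tendsto_tvDistance_pi_gaussianReal {m : ∀ n : ℕ, Fin n → ℝ} {d : ℕ → ℝ} {L M : ℝ}
    (hd0 : ∀ n, 0 ≤ d n) (hd : Tendsto d atTop (𝓝 0))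
    (hL : Tendsto (fun n : ℕ => (n : ℝ) * d n ^ 2) atTop (𝓝 L))
    (hM : Tendsto (fun n => ∑ i, m n i ^ 2) atTop (𝓝 M)) (hpos : 0 < L / 2 + M) :
    Tendsto (fun n => tvDistance
        (Measure.pi fun i => gaussianReal (m n i) ((1 + d n)⁻¹).toNNReal)
        (Measure.pi fun _ : Fin n => gaussianReal 0 1)) atTop
      (𝓝 (errorFn (√(L / 2 + M) / (2 * √2)))) := by
  have hmeas (n : ℕ) : Measurable
      fun x : Fin n → ℝ => ∑ i, gaussianLogRatio (d n) (m n i) (x i) := by fun_prop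
  have hchar (u : ℝ) := tendsto_charFun_map_sum_gaussianLogRatio hd0 hd hL hM u
  rw [← Real.sq_sqrt hpos.le] at hchar
  exact tendsto_tvDistance_of_tendsto_charFun (α := fun n => Fin n → ℝ)
    (μ := fun n => Measure.pi fun i => gaussianReal (m n i) ((1 + d n)⁻¹).toNNReal)
    (ν := fun n => Measure.pi fun _ : Fin n => gaussianReal 0 1)
    hmeas (fun n => pi_gaussianReal_eq_withDensity (hd0 n) (m n)) (Real.sqrt_pos.2 hpos) hchar

end Limit

/-! ### Cutoff times and limiting profiles. -/

section Cutoff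

/-- Convergence of the total variation distance along times `t n` for which the two effective
parameters of the experiment, the variance defect and the squared mean, converge. -/
theorem tendsto_tvDistance_map_ou
    {Ω : ℕ → Type*} [∀ n, MeasurableSpace (Ω n)]
    (P : ∀ n, Measure (Ω n)) [∀ n, IsProbabilityMeasure (P n)]
    (z₀ : ∀ n : ℕ, EuclideanSpace ℝ (Fin n))
    (Z B : ∀ n : ℕ, ℝ≥0 → Ω n → EuclideanSpace ℝ (Fin n))
    (hZ : ∀ n, 1 ≤ n → IsOUProcess (Z n) (B n) (z₀ n) (P n)) (t : ℕ → ℝ≥0) {L M : ℝ}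
    (ht : Tendsto (fun n => (t n : ℝ)) atTop atTop)
    (hL : Tendsto (fun n : ℕ => (n : ℝ) * Real.exp (-2 * t n) ^ 2) atTop (𝓝 L))
    (hM : Tendsto (fun n : ℕ => n * Real.exp (-2 * t n) * ‖z₀ n‖ ^ 2) atTop (𝓝 M))
    (hpos : 0 < L / 2 + M) :
    Tendsto (fun n => tvDistance ((P n).map (Z n (t n))) (ouInvariantLaw n)) atTop
      (𝓝 (errorFn (√(L / 2 + M) / (2 * √2)))) := by
  have hq : Tendsto (fun n => Real.exp (-2 * t n)) atTop (𝓝 0) :=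
    Real.tendsto_exp_atBot.comp (ht.const_mul_atTop_of_neg (by norm_num))
  have hq1 (n : ℕ) : Real.exp (-2 * t n) ≤ 1 :=
    Real.exp_le_one_iff.2 (by have := (t n).2; linarith)
  -- Chosen so that `(1 + d n)⁻¹ = 1 - e^{-2 t n}` when `t n > 0`. At `t n = 0` the inverse of zero
  -- is zero, so `0 ≤ d n` still holds for every `n`.
  set d : ℕ → ℝ := fun n => Real.exp (-2 * t n) * (1 - Real.exp (-2 * t n))⁻¹ with hd
  have hinv : Tendsto (fun n => (1 - Real.exp (-2 * t n))⁻¹) atTop (𝓝 1) := by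
    have := (hq.const_sub 1).inv₀ (by norm_num)
    simpa using this
  have hd0 (n : ℕ) : 0 ≤ d n := by
    have := hq1 n
    exact mul_nonneg (Real.exp_pos _).le (inv_nonneg.2 (by linarith))
  have hdlim : Tendsto d atTop (𝓝 0) := by
    simpa only [zero_mul] using hq.mul hinv
  have hdL : Tendsto (fun n : ℕ => (n : ℝ) * d n ^ 2) atTop (𝓝 L) := by
    have := hL.mul (hinv.pow 2)
    simp only [one_pow, mul_one] at this
    refine this.congr fun n => ?_
    simp only [hd]
    ring
  have hmM : Tendsto (fun n : ℕ => ∑ i, (√(n : ℝ) * Real.exp (-t n) * z₀ n i) ^ 2) atTop (𝓝 M) := by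
    refine hM.congr fun n => ?_
    rw [EuclideanSpace.real_norm_sq_eq, Finset.mul_sum]
    refine Finset.sum_congr rfl fun i _ => ?_
    rw [mul_pow, mul_pow, Real.sq_sqrt (by positivity), ← Real.exp_nat_mul]
    congr 3
    push_cast
    ring
  refine (tendsto_tvDistance_pi_gaussianReal hd0 hdlim hdL hmM hpos).congr' ?_
  filter_upwards [eventually_ge_atTop 1, hq.eventually_lt_const one_pos] with n hn hqn
  have hn0 : n ≠ 0 := by omega
  have hvar : (1 + d n)⁻¹ = 1 - Real.exp (-2 * t n) := by
    have h : 1 - Real.exp (-2 * t n) ≠ 0 := by linarith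
    refine inv_eq_iff_eq_inv.2 ?_
    rw [hd, eq_comm, inv_eq_one_div, div_eq_iff h, add_mul, mul_assoc, inv_mul_cancel₀ h]
    ring
  rw [(hZ n hn).map_eq hn0, ouInvariantLaw_eq hn0, tvDistance_map_measurableEquiv, hvar]

lemma ouProfile_top (b : ℝ) :
    ouProfile ∞ b = errorFn (√(0 / 2 + Real.exp (-2 * b)) / (2 * √2)) := by
  have : √(0 / 2 + Real.exp (-2 * b)) = Real.exp (-b) := by
    rw [zero_div, zero_add, show -2 * b = -b + -b by ring, Real.exp_add,
      Real.sqrt_mul_self (Real.exp_pos _).le]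
  rw [this, ouProfile, if_pos rfl]

lemma ouProfile_of_ne_top {a : ℝ≥0∞} (ha : a ≠ ∞) (b : ℝ) :
    ouProfile a b
      = errorFn (√(Real.exp (-4 * b) / 2 + a.toReal * Real.exp (-2 * b)) / (2 * √2)) := by
  have h8 : 2 * √2 = √8 := by
    rw [show (8 : ℝ) = 2 ^ 2 * 2 by norm_num, Real.sqrt_mul (by positivity),
      Real.sqrt_sq (by positivity)]
  have h16 : (4 : ℝ) = √16 := by
    rw [show (16 : ℝ) = 4 ^ 2 by norm_num, Real.sqrt_sq (by positivity)]
  have key : √(Real.exp (-4 * b) / 2 + a.toReal * Real.exp (-2 * b)) / (2 * √2)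
      = √(2 * a.toReal * Real.exp (-2 * b) + Real.exp (-4 * b)) / 4 := by
    have hnn : 0 ≤ a.toReal := ENNReal.toReal_nonneg
    rw [h8, ← Real.sqrt_div (by positivity)]
    have h4 (x : ℝ) (hx : 0 ≤ x) : √x / 4 = √(x / 16) := by rw [Real.sqrt_div hx, ← h16]
    rw [h4 _ (by positivity)]
    congr 1
    ring
  rw [key, ouProfile, if_neg ha]
  split_ifs with h0
  · have : √(Real.exp (-4 * b)) = Real.exp (-2 * b) := by
      rw [show -4 * b = -2 * b + -2 * b by ring, Real.exp_add,
        Real.sqrt_mul_self (Real.exp_pos _).le]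
    rw [h0, ENNReal.toReal_zero, mul_zero, zero_mul, zero_add, this]
  · rfl

end Cutoff

/-- For every `b` the time `t_{n,b}` is nonnegative for all large `n`, so that `Real.toNNReal`
does not change it there. -/
theorem lemma3p2
    {Ω : ℕ → Type*} [∀ n, MeasurableSpace (Ω n)]
    (P : ∀ n, Measure (Ω n)) [∀ n, IsProbabilityMeasure (P n)]
    (z₀ : ∀ n : ℕ, EuclideanSpace ℝ (Fin n))
    (Z B : ∀ n : ℕ, ℝ≥0 → Ω n → EuclideanSpace ℝ (Fin n))
    (hZ : ∀ n, 1 ≤ n → IsOUProcess (Z n) (B n) (z₀ n) (P n))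
    (a : ℝ≥0∞)
    (ha : Tendsto (fun n : ℕ => ENNReal.ofReal (‖z₀ n‖ ^ 2 * √(n : ℝ))) atTop (𝓝 a)) :
    (∀ b : ℝ,
      Tendsto
        (fun n : ℕ =>
          tvDistance
            ((P n).map (Z n (ouCutoffTime a ‖z₀ n‖ n b).toNNReal))
            (ouInvariantLaw n))
        atTop (𝓝 (ouProfile a b))) ∧
    (∀ u : ℝ, errorFn u = (gaussianReal 0 1).real {x : ℝ | |x| ≤ √2 * u}) := by
  refine ⟨fun b => ?_, errorFn_eq_gaussianReal⟩
  have hnat : Tendsto (fun n : ℕ => (n : ℝ)) atTop atTop := tendsto_natCast_atTop_atTop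
  have hcoe {T : ℕ → ℝ} (hT : Tendsto T atTop atTop) :
      ∀ᶠ n in atTop, ((T n).toNNReal : ℝ) = T n :=
    (hT.eventually_ge_atTop 0).mono fun n hn => Real.coe_toNNReal _ hn
  rcases eq_or_ne a ∞ with rfl | hfin
  · have hr : Tendsto (fun n : ℕ => ‖z₀ n‖ ^ 2 * √(n : ℝ)) atTop atTop :=
      ENNReal.tendsto_ofReal_nhds_top.1 ha
    have hsqrt : Tendsto (fun n : ℕ => √(n : ℝ)) atTop atTop := Real.tendsto_sqrt_atTop.comp hnat
    have hpos : ∀ᶠ n : ℕ in atTop, 0 < ‖z₀ n‖ ∧ 0 < √(n : ℝ) := by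
      filter_upwards [hr.eventually_gt_atTop 0, hsqrt.eventually_gt_atTop 0] with n h1 h2
      refine ⟨(norm_nonneg _).lt_of_ne fun h => ?_, h2⟩
      simp [← h] at h1
    have hT : Tendsto (fun n : ℕ => ouCutoffTime ∞ ‖z₀ n‖ n b) atTop atTop := by
      -- Uses `log (|z₀| √n) = (1/2) log ((|z₀|² √n) √n)`.
      have := (Real.tendsto_log_atTop.comp (hr.atTop_mul_atTop₀ hsqrt)).atTop_div_const two_pos
      refine (tendsto_atTop_add_const_right _ b this).congr fun n => ?_
      rw [ouCutoffTime, if_pos rfl, Function.comp_apply, mul_assoc, ← sq, ← mul_pow, Real.log_pow]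
      push_cast
      ring
    have hexp : ∀ᶠ n : ℕ in atTop, Real.exp (-2 * ((ouCutoffTime ∞ ‖z₀ n‖ n b).toNNReal : ℝ))
        = Real.exp (-2 * b) / (‖z₀ n‖ * √(n : ℝ)) ^ 2 := by
      filter_upwards [hcoe hT, hpos] with n hn hp
      rw [hn, ouCutoffTime, if_pos rfl, mul_add, add_comm, Real.exp_add, div_eq_mul_inv]
      congr 1
      rw [neg_mul, Real.exp_neg, show (2 : ℝ) = (2 : ℕ) by norm_num, Real.exp_nat_mul,
        Real.exp_log (mul_pos hp.1 hp.2)]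
    rw [ouProfile_top]
    -- Here `L = 0`, because `n e^{-4t} = e^{-4b} / (|z₀|² √n)²`, and `M = e^{-2b}` exactly for
    -- large `n`.
    refine tendsto_tvDistance_map_ou P z₀ Z B hZ _ (tendsto_atTop_mono (fun n => le_max_left _ _) hT)
      ?_ ?_ (by positivity)
    · have := (hr.inv_tendsto_atTop.pow 2).const_mul (Real.exp (-2 * b) ^ 2)
      simp only [ne_eq, OfNat.ofNat_ne_zero, not_false_eq_true, zero_pow, mul_zero] at this
      refine this.congr' ?_
      filter_upwards [hexp, hpos] with n hn hp
      have hs : (n : ℝ) = √(n : ℝ) ^ 2 := (Real.sq_sqrt (by positivity)).symm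
      rw [hn, Pi.inv_apply]
      nth_rewrite 2 [hs]
      have := hp.1
      have := hp.2
      field_simp
    · refine tendsto_const_nhds.congr' ?_
      filter_upwards [hexp, hpos] with n hn hp
      have hs : (n : ℝ) = √(n : ℝ) ^ 2 := (Real.sq_sqrt (by positivity)).symm
      rw [hn]
      nth_rewrite 1 [hs]
      have := hp.1
      have := hp.2
      field_simp
  · have hr : Tendsto (fun n : ℕ => ‖z₀ n‖ ^ 2 * √(n : ℝ)) atTop (𝓝 a.toReal) := by
      refine ((ENNReal.tendsto_toReal hfin).comp ha).congr fun n => ?_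
      exact ENNReal.toReal_ofReal (by positivity)
    have hT : Tendsto (fun n : ℕ => ouCutoffTime a ‖z₀ n‖ n b) atTop atTop := by
      have := (Real.tendsto_log_atTop.comp hnat).atTop_div_const (show (0 : ℝ) < 4 by norm_num)
      refine (tendsto_atTop_add_const_right _ b this).congr fun n => ?_
      rw [ouCutoffTime, if_neg hfin]
      rfl
    have hexp : ∀ᶠ n : ℕ in atTop, Real.exp (-2 * ((ouCutoffTime a ‖z₀ n‖ n b).toNNReal : ℝ))
        = Real.exp (-2 * b) / √(n : ℝ) ∧ 0 < √(n : ℝ) := by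
      filter_upwards [hcoe hT, eventually_ge_atTop 1] with n hn hn1
      have hn0 : (0 : ℝ) < n := by exact_mod_cast hn1
      refine ⟨?_, Real.sqrt_pos.2 hn0⟩
      rw [hn, ouCutoffTime, if_neg hfin, mul_add, add_comm, Real.exp_add, div_eq_mul_inv]
      congr 1
      rw [← Real.exp_log (inv_pos.2 (Real.sqrt_pos.2 hn0)), Real.log_inv, Real.log_sqrt hn0.le]
      congr 1
      ring
    rw [ouProfile_of_ne_top hfin]
    -- Now `e^{-2t} = e^{-2b}/√n`, giving `L = e^{-4b}` and `M = a e^{-2b}`; the positivity of `L`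
    -- covers `a = 0` as well.
    refine tendsto_tvDistance_map_ou P z₀ Z B hZ _ (tendsto_atTop_mono (fun n => le_max_left _ _) hT)
      ?_ ?_ (by have : 0 ≤ a.toReal := ENNReal.toReal_nonneg; positivity)
    · refine tendsto_const_nhds.congr' ?_
      filter_upwards [hexp] with n hn
      have hs : √(n : ℝ) ^ 2 = n := Real.sq_sqrt (by positivity)
      have hne : (n : ℝ) ≠ 0 := by rw [← hs]; exact (pow_pos hn.2 2).ne'
      rw [hn.1, div_pow, hs, mul_div_cancel₀ _ hne, ← Real.exp_nat_mul]
      congr 1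
      push_cast
      ring
    · refine (hr.mul_const (Real.exp (-2 * b))).congr' ?_
      filter_upwards [hexp] with n hn
      have hs : (n : ℝ) = √(n : ℝ) ^ 2 := (Real.sq_sqrt (by positivity)).symm
      have := hn.2
      rw [hn.1]
      nth_rewrite 2 [hs]
      field_simp
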